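/- Let $\pi$ be a permutation of size at least $2$. Let $\mathrm{ex}_\pi(m)$ be the maximum number of ones in an $m\times m$ 0-1 matrix that avoids (the permutation matrix of) $\pi$, that is, a matrix from which the permutation matrix of $\pi$ cannot be obtained by deleting rows and columns and turning ones into zeros. Let $c_\pi=\lim_{m\to\infty}\mathrm{ex}_\pi(m)/m$ be the Füredi–Hajnal limit of $\pi$ (this limit exists and is finite). For a sequence $X=(x_1,\dots,x_n)\in[0,1]^n$ and $k\ge 1$, let $\mathrm{OPT}_k(X)$ be the offline $k$-server optimum on the line: the minimum of $\sum_{i=1}^n\sum_{j=1}^k|p_i^j-p_{i-1}^j|$ over all positions $p_i^j\in[0,1]$ ($0\le i\le n$, $1\le j\le k$) such that $p_0^j=0$ for all $j$ and for every $i\ge1$ there is some $j$ with $p_i^j=x_i$. Then, for every $k\ge1$, every $n$ and every sequence $X\in[0,1]^n$ of pairwise distinct reals that avoids $\pi$ (no subsequence of $X$ is order-isomorphic to $\pi$), $$\mathrm{OPT}_k(X)\;\le\; C\cdot k^{\,1+\log_{5c_\pi}120}\cdot n^{1/(\lfloor\log_{5c_\pi}k\rfloor+1)},$$ where $C>0$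 is an absolute constant, independent of $\pi$, $k$, $n$ and $X$. -/

import Mathlib

open Filter Topology

/-- The real sequence `X` contains the permutation `π`: some (not necessarily contiguous)
subsequence of `X` is order-isomorphic to `π`. -/
def SeqContains {n t : ℕ} (X : Fin n → ℝ) (π : Equiv.Perm (Fin t)) : Prop :=
  ∃ f : Fin t → Fin n, StrictMono f ∧ ∀ i j : Fin t, X (f i) < X (f j) ↔ π i < π j

/-- The real sequence `X` avoids the permutation `π`. -/
def SeqAvoids {n t : ℕ} (X : Fin n → ℝ) (π : Equiv.Perm (Fin t)) : Prop :=
  ¬ SeqContains X π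

/-- The permutation matrix of `π`: the entry of column `j` in row `π j` is one, all others are
zero. Entries are written (row, column); `true` stands for one and `false` for zero. -/
def patternMatrix {t : ℕ} (π : Equiv.Perm (Fin t)) : Matrix (Fin t) (Fin t) Bool :=
  fun i j => decide (i = π j)

/-- The 0-1 matrix `M` contains the 0-1 matrix `P`: `P` arises from a submatrix of `M` by turning
zero or more ones into zeros. -/
def MatrixContains {m n a b : ℕ} (M : Matrix (Fin m) (Fin n) Bool)
    (P : Matrix (Fin a) (Fin b) Bool) : Prop :=
  ∃ (r : Fin a → Fin m) (c : Fin b → Fin n), StrictMono r ∧ StrictMono c ∧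
    ∀ i j, P i j = true → M (r i) (c j) = true

/-- The number of ones of a 0-1 matrix. -/
def onesCount {m n : ℕ} (M : Matrix (Fin m) (Fin n) Bool) : ℕ :=
  (Finset.univ.filter (fun p : Fin m × Fin n => M p.1 p.2 = true)).card

/-- The maximum number of ones of an `n × n` 0-1 matrix that avoids `π` (a maximum over a finite
set). -/
noncomputable def exPattern {t : ℕ} (π : Equiv.Perm (Fin t)) (n : ℕ) : ℕ :=
  sSup {w : ℕ | ∃ M : Matrix (Fin n) (Fin n) Bool,
    ¬ MatrixContains M (patternMatrix π) ∧ onesCount M = w}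

/-- The Füredi-Hajnal limit of `π`, i.e. the limit of `ex_π(n) / n`. -/
noncomputable def furediHajnalLimit {t : ℕ} (π : Equiv.Perm (Fin t)) : ℝ :=
  limUnder atTop (fun n : ℕ => (exPattern π n : ℝ) / (n : ℝ))

/-- `p` is a valid solution with `k` servers for the requests `X`: `p i j` is the position in
`[0,1]` of server `j` after the first `i` requests, all servers start at `0`, and after each
request some server is located at the requested value. -/
structure IsKServerSolution {n : ℕ} (k : ℕ) (X : Fin n → ℝ)
    (p : Fin (n + 1) → Fin k → ℝ) : Prop where
  mem_Icc : ∀ i j, p i j ∈ Set.Icc (0 : ℝ) 1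
  start : ∀ j, p 0 j = 0
  serves : ∀ i : Fin n, ∃ j, p i.succ j = X i

/-- The cost of a solution: the total movement of all servers. -/
def kServerCost {n k : ℕ} (p : Fin (n + 1) → Fin k → ℝ) : ℝ :=
  ∑ i : Fin n, ∑ j : Fin k, |p i.succ j - p i.castSucc j|

/-- The offline optimum `OPT_k(X)`: the minimum cost of a valid solution. -/
noncomputable def kServerOPT {n : ℕ} (k : ℕ) (X : Fin n → ℝ) : ℝ :=
  sInf {c : ℝ | ∃ p : Fin (n + 1) → Fin k → ℝ, IsKServerSolution k X p ∧ kServerCost p = c}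

/-! Cut the value range into `m` strips and time greedily into blocks, each meeting at most `q`
strips and, except for the last, at least `q`. If there were `m` full blocks, the strip-by-block
incidence matrix would be an `m × m` matrix with at least `q * m` ones. For `q > c` this exceeds the
extremal number, so the matrix contains `π`, and a copy of `π` there lifts to one in `X`. Hence
there are at most `m` blocks (`greedy_blocks_lt`).

Within a block, each strip that occurs gets its own group of servers, and each group recurses inside
its strip, now `m` times thinner. Regrouping costs at most the range per server and block. With `q ^
l` servers, `l` levels cost `q ^ l * (l * m + n / m ^ l)` (`hasSchedule_combine`,
`hasSchedule_levels`); `m` about `n ^ (1 / (l + 1))` balances the two terms.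

The block count needs `ex(m) ≤ c * m` for every `m`, not only asymptotically. This is Fekete's lemma
(`furediHajnal_spec`): `ex` is superadditive, and `ex(m) / m` is bounded by the Marcus-Tardos
theorem. -/

/-- The finite set `A` of (row, column) positions contains the permutation matrix of `π`. -/
def PointsContain {t : ℕ} (A : Finset (ℕ × ℕ)) (π : Equiv.Perm (Fin t)) : Prop :=
  ∃ r c : Fin t → ℕ, StrictMono r ∧ StrictMono c ∧ ∀ j, (r (π j), c j) ∈ A

lemma onesCount_le_sq {m : ℕ} (M : Matrix (Fin m) (Fin m) Bool) : onesCount M ≤ m * m := by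
  refine (Finset.card_le_univ _).trans ?_
  simp

lemma exPattern_bddAbove {t : ℕ} (π : Equiv.Perm (Fin t)) (m : ℕ) :
    BddAbove {w : ℕ | ∃ M : Matrix (Fin m) (Fin m) Bool,
      ¬ MatrixContains M (patternMatrix π) ∧ onesCount M = w} := by
  refine ⟨m * m, ?_⟩
  rintro w ⟨M, -, rfl⟩
  exact onesCount_le_sq M

lemma card_le_exPattern {t : ℕ} (π : Equiv.Perm (Fin t)) {m : ℕ} {A : Finset (ℕ × ℕ)}
    (hA : A ⊆ Finset.range m ×ˢ Finset.range m) (h : ¬ PointsContain A π) :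
    A.card ≤ exPattern π m := by
  refine le_csSup (exPattern_bddAbove π m)
    ⟨fun i j => decide (((i : ℕ), (j : ℕ)) ∈ A), ?_, ?_⟩
  · rintro ⟨r, c, hr, hc, hrc⟩
    refine h ⟨fun i => r i, fun j => c j, fun _ _ h => hr h, fun _ _ h => hc h, fun j => ?_⟩
    simpa using hrc (π j) j (by simp [patternMatrix])
  · unfold onesCount
    refine Finset.card_bij (fun p _ => ((p.1 : ℕ), (p.2 : ℕ))) ?_ ?_ ?_
    · intro p hp
      simpa using hp
    · rintro ⟨a, b⟩ _ ⟨c, d⟩ _ h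
      simpa [Fin.ext_iff] using h
    · rintro ⟨a, b⟩ hab
      have := hA hab
      simp only [Finset.mem_product, Finset.mem_range] at this
      exact ⟨(⟨a, this.1⟩, ⟨b, this.2⟩), by simpa using hab, rfl⟩

lemma exists_card_eq_exPattern {t : ℕ} (ht : 0 < t) (π : Equiv.Perm (Fin t)) (m : ℕ) :
    ∃ A : Finset (ℕ × ℕ), A ⊆ Finset.range m ×ˢ Finset.range m ∧ ¬ PointsContain A π ∧
      A.card = exPattern π m := by
  have hne : {w : ℕ | ∃ M : Matrix (Fin m) (Fin m) Bool,
      ¬ MatrixContains M (patternMatrix π) ∧ onesCount M = w}.Nonempty := by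
    refine ⟨_, fun _ _ => false, ?_, rfl⟩
    rintro ⟨r, c, -, -, h⟩
    simpa using h (π ⟨0, ht⟩) ⟨0, ht⟩ (by simp [patternMatrix])
  obtain ⟨M, hM, hw⟩ := Nat.sSup_mem hne (exPattern_bddAbove π m)
  refine ⟨(Finset.univ.filter (fun p : Fin m × Fin m => M p.1 p.2 = true)).image
    (fun p => ((p.1 : ℕ), (p.2 : ℕ))), ?_, ?_, ?_⟩
  · intro p hp
    simp only [Finset.mem_image] at hp
    obtain ⟨x, -, rfl⟩ := hp
    simp
  · rintro ⟨r, c, hr, hc, h⟩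
    simp only [Finset.mem_image, Finset.mem_filter, Finset.mem_univ, true_and, Prod.mk.injEq] at h
    choose x hx hx1 hx2 using h
    refine hM ⟨fun i => (x (π.symm i)).1, fun j => (x j).2, ?_, ?_, ?_⟩
    · intro i j hij
      simpa [Fin.lt_def, hx1] using hr hij
    · intro i j hij
      simpa [Fin.lt_def, hx2] using hc hij
    · intro i j hij
      obtain rfl : i = π j := by simpa [patternMatrix] using hij
      simpa using hx j
  · rw [Finset.card_image_of_injective _ (fun p q h => by simpa [Prod.ext_iff, Fin.ext_iff] using h)]
    exact hw

/-! ### Superadditivity of the extremal function -/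

/-- Superadditivity from a placement of two blocks that cannot create a new copy of `π`: the
first block is shifted by `u` rows, the second one by `v` rows and `m` columns. -/
lemma exPattern_superadditive_of_placement {t : ℕ} (ht : 0 < t) (π : Equiv.Perm (Fin t))
    {m n u v : ℕ} (huv : (u = 0 ∧ v = m) ∨ (u = n ∧ v = 0))
    (hπ : ∀ b : Fin t → Prop, (∀ i j, i ≤ j → b j → b i) → (∃ i, b i) → (∃ i, ¬ b i) →
      ∃ i j, b i ∧ ¬ b j ∧ (v = 0 → π i < π j) ∧ (u = 0 → π j < π i)) (hm : 0 < m) (hn : 0 < n) :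
    exPattern π m + exPattern π n ≤ exPattern π (m + n) := by
  obtain ⟨A, hA, hAπ, hAc⟩ := exists_card_eq_exPattern ht π m
  obtain ⟨B, hB, hBπ, hBc⟩ := exists_card_eq_exPattern ht π n
  have hA' : ∀ x y, (x, y) ∈ A → x < m ∧ y < m := fun x y h => by simpa using hA h
  have hB' : ∀ x y, (x, y) ∈ B → x < n ∧ y < n := fun x y h => by simpa using hB h
  set A' := A.image (fun p => (p.1 + u, p.2)) with hAeq
  set B' := B.image (fun p => (p.1 + v, p.2 + m)) with hBeq
  have memA : ∀ x y, (x, y) ∈ A' → y < m ∧ u ≤ x ∧ x < m + u ∧ (x - u, y) ∈ A := by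
    intro x y h
    simp only [hAeq, Finset.mem_image, Prod.exists, Prod.mk.injEq] at h
    obtain ⟨x', y', h, rfl, rfl⟩ := h
    have := hA' _ _ h
    refine ⟨this.2, by omega, by omega, by simpa using h⟩
  have memB : ∀ x y, (x, y) ∈ B' → m ≤ y ∧ v ≤ x ∧ x < n + v ∧ y < m + n ∧
      (x - v, y - m) ∈ B := by
    intro x y h
    simp only [hBeq, Finset.mem_image, Prod.exists, Prod.mk.injEq] at h
    obtain ⟨x', y', h, rfl, rfl⟩ := h
    have := hB' _ _ h
    refine ⟨by omega, by omega, by omega, by omega, by simpa using h⟩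
  have hdisj : Disjoint A' B' := by
    rw [Finset.disjoint_left]
    rintro ⟨x, y⟩ h1 h2
    have := memA _ _ h1
    have := memB _ _ h2
    omega
  have hcard : (A' ∪ B').card = A.card + B.card := by
    rw [Finset.card_union_of_disjoint hdisj, Finset.card_image_of_injective,
      Finset.card_image_of_injective]
    · rintro ⟨a, b⟩ ⟨c, d⟩ h
      simpa using h
    · rintro ⟨a, b⟩ ⟨c, d⟩ h
      simpa using h
  rw [← hAc, ← hBc, ← hcard]
  refine card_le_exPattern π ?_ ?_
  · rintro ⟨x, y⟩ h
    simp only [Finset.mem_product, Finset.mem_range]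
    rcases Finset.mem_union.1 h with h | h
    · have := memA _ _ h
      omega
    · have := memB _ _ h
      omega
  · rintro ⟨r, c, hr, hc, h⟩
    have hb : ∀ j, c j < m → (r (π j), c j) ∈ A' := fun j hj => by
      rcases Finset.mem_union.1 (h j) with h | h
      · exact h
      · have := memB _ _ h
        omega
    have hb' : ∀ j, ¬ c j < m → (r (π j), c j) ∈ B' := fun j hj => by
      rcases Finset.mem_union.1 (h j) with h | h
      · have := memA _ _ h
        omega
      · exact h
    by_cases h1 : ∀ j, c j < m
    · refine hAπ ⟨fun i => r i - u, c, fun i j hij => ?_, hc, fun j => (memA _ _ (hb j (h1 j))).2.2.2⟩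
      have e1 := memA _ _ (hb (π.symm i) (h1 _))
      have e2 := memA _ _ (hb (π.symm j) (h1 _))
      have := hr hij
      simp only [Equiv.apply_symm_apply] at e1 e2
      show r i - u < r j - u
      omega
    by_cases h2 : ∀ j, ¬ c j < m
    · refine hBπ ⟨fun i => r i - v, fun j => c j - m, fun i j hij => ?_, fun i j hij => ?_,
        fun j => (memB _ _ (hb' j (h2 j))).2.2.2.2⟩
      · have e1 := memB _ _ (hb' (π.symm i) (h2 _))
        have e2 := memB _ _ (hb' (π.symm j) (h2 _))
        have := hr hij
        simp only [Equiv.apply_symm_apply] at e1 e2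
        show r i - v < r j - v
        omega
      · have := hc hij
        have := h2 i
        show c i - m < c j - m
        omega
    push Not at h1 h2
    -- The copy straddles both blocks, so `hπ` yields two columns whose order under `π` is opposite
    -- to the vertical order of the blocks.
    obtain ⟨i, j, hi, hj, hv, hu⟩ := hπ (fun j => c j < m)
      (fun i j hij hj => lt_of_le_of_lt (hc.monotone hij) hj) h2
      (h1.imp fun _ h => by omega)
    have e1 := memA _ _ (hb i hi)
    have e2 := memB _ _ (hb' j hj)
    rcases huv with ⟨rfl, rfl⟩ | ⟨rfl, rfl⟩
    · have := hr (hu rfl)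
      omega
    · have := hr (hv rfl)
      omega

lemma exPattern_zero {t : ℕ} (ht : 0 < t) (π : Equiv.Perm (Fin t)) : exPattern π 0 = 0 := by
  obtain ⟨A, hA, -, hc⟩ := exists_card_eq_exPattern ht π 0
  rw [← hc]
  simpa using hA

/-- If no cut of the columns puts all left values of `π` above all right values, the first block can
be placed above the second in row index: a straddling copy would be such a cut. If there is such a
cut, the first column of `π` has a larger value than the last, and every cut separates these two;
the opposite diagonal placement then works. -/
lemma exPattern_superadditive {t : ℕ} (ht : 0 < t) (π : Equiv.Perm (Fin t)) (m n : ℕ) :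
    exPattern π m + exPattern π n ≤ exPattern π (m + n) := by
  rcases Nat.eq_zero_or_pos m with rfl | hm
  · simp [exPattern_zero ht]
  rcases Nat.eq_zero_or_pos n with rfl | hn
  · simp [exPattern_zero ht]
  by_cases h : ∀ b : Fin t → Prop, (∀ i j, i ≤ j → b j → b i) → (∃ i, b i) → (∃ i, ¬ b i) →
      ∃ i j, b i ∧ ¬ b j ∧ π i < π j
  · refine exPattern_superadditive_of_placement ht π (u := n) (v := 0) (Or.inr ⟨rfl, rfl⟩) ?_ hm hn
    intro b hb h1 h2
    obtain ⟨i, j, hi, hj, hij⟩ := h b hb h1 h2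
    exact ⟨i, j, hi, hj, fun _ => hij, fun h => by omega⟩
  · refine exPattern_superadditive_of_placement ht π (u := 0) (v := m) (Or.inl ⟨rfl, rfl⟩) ?_ hm hn
    intro b hb ⟨i₀, hi₀⟩ ⟨j₀, hj₀⟩
    push Not at h
    obtain ⟨b', hb', ⟨i₁, hi₁⟩, ⟨j₁, hj₁⟩, h⟩ := h
    have hfst : ∀ i, (⟨0, ht⟩ : Fin t) ≤ i := fun i => by simp [Fin.le_def]
    have hlst : ∀ i, i ≤ (⟨t - 1, by omega⟩ : Fin t) := fun i => by
      have := i.2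
      rw [Fin.le_def]
      show (i : ℕ) ≤ t - 1
      omega
    have b0 := hb _ _ (hfst _) hi₀
    have b1 : ¬ b ⟨t - 1, by omega⟩ := fun hh => hj₀ (hb _ _ (hlst _) hh)
    have b0' := hb' _ _ (hfst _) hi₁
    have b1' : ¬ b' ⟨t - 1, by omega⟩ := fun hh => hj₁ (hb' _ _ (hlst _) hh)
    refine ⟨_, _, b0, b1, fun hh => by omega, fun _ => lt_of_le_of_ne (h _ _ b0' b1') ?_⟩
    intro he
    exact b1 (π.injective he ▸ b0)

/-! ### The Marcus-Tardos theorem -/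

/-- Placing a copy of `π` in a column strip: `t` rows of blocks, each of which has a point in each
of the columns of a common `t`-set. -/
lemma pointsContain_of_common_columns {t s : ℕ} {A : Finset (ℕ × ℕ)} (π : Equiv.Perm (Fin t))
    {R T : Finset ℕ} (hR : R.card = t) (hT : T.card = t)
    (h : ∀ x ∈ R, ∀ y ∈ T, ∃ z, z / s = x ∧ (z, y) ∈ A) : PointsContain A π := by
  choose! z hz1 hz2 using h
  refine ⟨fun i => z (R.orderEmbOfFin hR i) (T.orderEmbOfFin hT (π.symm i)),
    T.orderEmbOfFin hT, ?_, (T.orderEmbOfFin hT).strictMono, fun j => ?_⟩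
  · intro i j hij
    by_contra hle
    have := Nat.div_le_div_right (c := s) (not_lt.1 hle)
    rw [hz1 _ (R.orderEmbOfFin_mem hR _) _ (T.orderEmbOfFin_mem hT _),
      hz1 _ (R.orderEmbOfFin_mem hR _) _ (T.orderEmbOfFin_mem hT _)] at this
    exact absurd ((R.orderEmbOfFin hR).strictMono hij) (not_lt.2 this)
  · simpa using hz2 _ (R.orderEmbOfFin_mem hR (π j)) _ (T.orderEmbOfFin_mem hT j)

/-- The points of `A` in the block `b` of the grid of `s × s` blocks. -/
def blockPoints (A : Finset (ℕ × ℕ)) (s : ℕ) (b : ℕ × ℕ) : Finset (ℕ × ℕ) :=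
  A.filter (fun p => (p.1 / s, p.2 / s) = b)

lemma mem_blockPoints {A : Finset (ℕ × ℕ)} {s : ℕ} {b p : ℕ × ℕ} :
    p ∈ blockPoints A s b ↔ p ∈ A ∧ p.1 / s = b.1 ∧ p.2 / s = b.2 := by
  simp [blockPoints, Prod.ext_iff]

/-- Few blocks of a column of blocks have points in `t` distinct columns. -/
lemma card_wide_blocks_le {t s : ℕ} (hs : 0 < s) {A : Finset (ℕ × ℕ)} (π : Equiv.Perm (Fin t))
    (hA : ¬ PointsContain A π) (y : ℕ) (R : Finset ℕ)
    (hR : ∀ x ∈ R, t ≤ ((blockPoints A s (x, y)).image Prod.snd).card) :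
    R.card ≤ t * s.choose t := by
  by_contra hlt
  push Not at hlt
  have hsub : ∀ x ∈ R, ∃ T ⊆ (blockPoints A s (x, y)).image Prod.snd, T.card = t :=
    fun x hx => Finset.exists_subset_card_eq (hR x hx)
  choose! T hT hTc using hsub
  have hmaps : ∀ x ∈ R, T x ∈ (Finset.Ico (y * s) (y * s + s)).powersetCard t := by
    intro x hx
    rw [Finset.mem_powersetCard]
    refine ⟨fun z hz => ?_, hTc x hx⟩
    obtain ⟨p, hp, rfl⟩ := Finset.mem_image.1 (hT x hx hz)
    have := (mem_blockPoints.1 hp).2.2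
    rw [Finset.mem_Ico]
    have h1 := Nat.div_add_mod p.2 s
    have h2 := Nat.mod_lt p.2 hs
    simp only [this] at h1
    rw [mul_comm] at h1
    omega
  -- Pigeonhole over the `s.choose t` possible column sets: more than `t` blocks share one.
  obtain ⟨T₀, hT₀, hfib⟩ := Finset.exists_lt_card_fiber_of_mul_lt_card_of_maps_to
    (n := t) hmaps (by simpa [mul_comm] using hlt)
  obtain ⟨R', hR', hR'c⟩ := Finset.exists_subset_card_eq hfib.le
  refine hA (pointsContain_of_common_columns π (s := s) hR'c (Finset.mem_powersetCard.1 hT₀).2 ?_)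
  intro x hx z hz
  obtain ⟨hx1, hx2⟩ := Finset.mem_filter.1 (hR' hx)
  rw [← hx2] at hz
  obtain ⟨p, hp, rfl⟩ := Finset.mem_image.1 (hT x hx1 hz)
  have := mem_blockPoints.1 hp
  exact ⟨p.1, this.2.1, this.1⟩

lemma pointsContain_swap {t : ℕ} {A : Finset (ℕ × ℕ)} {π : Equiv.Perm (Fin t)}
    (h : PointsContain (A.image Prod.swap) π⁻¹) : PointsContain A π := by
  obtain ⟨r, c, hr, hc, h⟩ := h
  refine ⟨c, r, hc, hr, fun j => ?_⟩
  simpa using h (π j)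

lemma blockPoints_image_swap (A : Finset (ℕ × ℕ)) (s x y : ℕ) :
    (blockPoints (A.image Prod.swap) s (y, x)).image Prod.snd =
      (blockPoints A s (x, y)).image Prod.fst := by
  ext z
  simp only [Finset.mem_image, mem_blockPoints, Prod.exists, Prod.swap_prod_mk, Prod.mk.injEq]
  constructor
  · rintro ⟨a, b, ⟨⟨c, d, h, rfl, rfl⟩, h1, h2⟩, rfl⟩
    exact ⟨_, _, ⟨h, h2, h1⟩, rfl⟩
  · rintro ⟨a, b, ⟨h, h1, h2⟩, rfl⟩
    exact ⟨_, _, ⟨⟨_, _, h, rfl, rfl⟩, h2, h1⟩, rfl⟩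

lemma card_tall_blocks_le {t s : ℕ} (hs : 0 < s) {A : Finset (ℕ × ℕ)} (π : Equiv.Perm (Fin t))
    (hA : ¬ PointsContain A π) (x : ℕ) (R : Finset ℕ)
    (hR : ∀ y ∈ R, t ≤ ((blockPoints A s (x, y)).image Prod.fst).card) :
    R.card ≤ t * s.choose t :=
  card_wide_blocks_le hs π⁻¹ (fun h => hA (pointsContain_swap h)) x R
    (fun y hy => (hR y hy).trans_eq (by rw [blockPoints_image_swap]))

lemma card_blockPoints_le (A : Finset (ℕ × ℕ)) {s : ℕ} (hs : 0 < s) (b : ℕ × ℕ) :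
    (blockPoints A s b).card ≤ s * s := by
  have : blockPoints A s b ⊆
      Finset.Ico (b.1 * s) (b.1 * s + s) ×ˢ Finset.Ico (b.2 * s) (b.2 * s + s) := by
    intro p hp
    obtain ⟨-, h1, h2⟩ := mem_blockPoints.1 hp
    have e1 := Nat.div_add_mod p.1 s
    have e2 := Nat.mod_lt p.1 hs
    have e3 := Nat.div_add_mod p.2 s
    have e4 := Nat.mod_lt p.2 hs
    rw [h1, mul_comm] at e1
    rw [h2, mul_comm] at e3
    simp only [Finset.mem_product, Finset.mem_Ico]
    omega
  simpa using Finset.card_le_card this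

lemma card_le_card_image_mul (B : Finset (ℕ × ℕ)) :
    B.card ≤ (B.image Prod.fst).card * (B.image Prod.snd).card := by
  rw [← Finset.card_product]
  exact Finset.card_le_card Finset.subset_product

/-- One point chosen from each block of a copy inherits the order of the blocks in both coordinates,
so copies lift from the contraction. -/
lemma not_pointsContain_contraction {t : ℕ} {A : Finset (ℕ × ℕ)} {π : Equiv.Perm (Fin t)}
    (hA : ¬ PointsContain A π) (s : ℕ) :
    ¬ PointsContain (A.image fun p => (p.1 / s, p.2 / s)) π := by
  rintro ⟨r, c, hr, hc, h⟩
  simp only [Finset.mem_image, Prod.mk.injEq] at h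
  choose p hp hp1 hp2 using h
  refine hA ⟨fun i => (p (π.symm i)).1, fun j => (p j).2, fun i j hij => ?_, fun i j hij => ?_,
    fun j => by simpa using hp j⟩
  · by_contra hle
    have := Nat.div_le_div_right (c := s) (not_lt.1 hle)
    simp only [hp1, Equiv.apply_symm_apply] at this
    exact absurd (hr hij) (not_lt.2 this)
  · by_contra hle
    have := Nat.div_le_div_right (c := s) (not_lt.1 hle)
    simp only [hp2] at this
    exact absurd (hc hij) (not_lt.2 this)

/-- The Marcus-Tardos recurrence. -/
lemma exPattern_recurrence {t : ℕ} (ht : 0 < t) (π : Equiv.Perm (Fin t)) {s : ℕ} (hs : 0 < s)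
    (n : ℕ) :
    exPattern π n ≤ (t - 1) ^ 2 * exPattern π (n / s + 1)
      + 2 * (t * s.choose t) * (s * s) * (n / s + 1) := by
  obtain ⟨A, hA, hAπ, hAc⟩ := exists_card_eq_exPattern ht π n
  rw [← hAc]
  set N := n / s + 1
  set Q := A.image fun p => (p.1 / s, p.2 / s) with hQ
  have hQN : Q ⊆ Finset.range N ×ˢ Finset.range N := by
    intro b hb
    obtain ⟨p, hp, rfl⟩ := Finset.mem_image.1 hb
    have hp' := hA hp
    simp only [Finset.mem_product, Finset.mem_range] at hp' ⊢
    exact ⟨Nat.lt_succ_of_le (Nat.div_le_div_right hp'.1.le),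
      Nat.lt_succ_of_le (Nat.div_le_div_right hp'.2.le)⟩
  have hQc : Q.card ≤ exPattern π N :=
    card_le_exPattern π hQN (not_pointsContain_contraction hAπ s)
  set W := Q.filter fun b => t ≤ ((blockPoints A s b).image Prod.snd).card with hW
  set H := Q.filter fun b => t ≤ ((blockPoints A s b).image Prod.fst).card with hH
  have hWc : W.card ≤ t * s.choose t * N := by
    have := Finset.card_le_mul_card_image_of_maps_to (s := W) (t := Finset.range N) (f := Prod.snd)
      (fun b hb => (Finset.mem_product.1 (hQN (Finset.mem_filter.1 hb).1)).2) (t * s.choose t)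
      (fun y hy => by
        rw [← Finset.card_image_of_injOn (f := Prod.fst)]
        · refine card_wide_blocks_le hs π hAπ y _ fun x hx => ?_
          obtain ⟨b, hb, rfl⟩ := Finset.mem_image.1 hx
          obtain ⟨hb1, rfl⟩ := Finset.mem_filter.1 hb
          exact (Finset.mem_filter.1 hb1).2
        · intro a ha b hb hab
          have ha := (Finset.mem_filter.1 ha).2
          have hb := (Finset.mem_filter.1 hb).2
          exact Prod.ext hab (ha.trans hb.symm))
    simpa using this
  have hHc : H.card ≤ t * s.choose t * N := by
    have := Finset.card_le_mul_card_image_of_maps_to (s := H) (t := Finset.range N) (f := Prod.fst)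
      (fun b hb => (Finset.mem_product.1 (hQN (Finset.mem_filter.1 hb).1)).1) (t * s.choose t)
      (fun x hx => by
        rw [← Finset.card_image_of_injOn (f := Prod.snd)]
        · refine card_tall_blocks_le hs π hAπ x _ fun y hy => ?_
          obtain ⟨b, hb, rfl⟩ := Finset.mem_image.1 hy
          obtain ⟨hb1, rfl⟩ := Finset.mem_filter.1 hb
          exact (Finset.mem_filter.1 hb1).2
        · intro a ha b hb hab
          have ha := (Finset.mem_filter.1 ha).2
          have hb := (Finset.mem_filter.1 hb).2
          exact Prod.ext (ha.trans hb.symm) hab)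
    simpa using this
  have hsum : A.card = ∑ b ∈ Q, (blockPoints A s b).card :=
    Finset.card_eq_sum_card_fiberwise fun p hp => Finset.mem_image_of_mem _ hp
  -- A block neither wide nor tall has fewer than `t` occupied rows and columns; the few others are
  -- charged all `s * s` cells.
  have hpt : ∀ b ∈ Q, (blockPoints A s b).card ≤
      (t - 1) ^ 2 + ((if b ∈ W then s * s else 0) + (if b ∈ H then s * s else 0)) := by
    intro b hb
    have h0 := card_blockPoints_le A hs b
    by_cases h1 : b ∈ W
    · simp only [h1, if_true]
      omega
    by_cases h2 : b ∈ H
    · simp only [h2, if_true]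
      omega
    simp only [hW, hH, Finset.mem_filter, hb, true_and, not_le] at h1 h2
    refine (card_le_card_image_mul _).trans ?_
    rw [sq]
    exact (Nat.mul_le_mul (Nat.le_sub_one_of_lt h2) (Nat.le_sub_one_of_lt h1)).trans
      (Nat.le_add_right _ _)
  have hWQ : ∑ b ∈ Q, (if b ∈ W then s * s else 0) = W.card * (s * s) := by
    rw [Finset.sum_ite_mem, Finset.inter_eq_right.2 (Finset.filter_subset _ _),
      Finset.sum_const, smul_eq_mul]
  have hHQ : ∑ b ∈ Q, (if b ∈ H then s * s else 0) = H.card * (s * s) := by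
    rw [Finset.sum_ite_mem, Finset.inter_eq_right.2 (Finset.filter_subset _ _),
      Finset.sum_const, smul_eq_mul]
  calc A.card = ∑ b ∈ Q, (blockPoints A s b).card := hsum
    _ ≤ _ := Finset.sum_le_sum hpt
    _ = Q.card * (t - 1) ^ 2 + (W.card * (s * s) + H.card * (s * s)) := by
        rw [Finset.sum_add_distrib, Finset.sum_add_distrib, hWQ, hHQ]
        simp
    _ ≤ exPattern π N * (t - 1) ^ 2 +
        (t * s.choose t * N * (s * s) + t * s.choose t * N * (s * s)) := by gcongr
    _ = _ := by ring

lemma exPattern_le_sq {t : ℕ} (ht : 0 < t) (π : Equiv.Perm (Fin t)) (n : ℕ) :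
    exPattern π n ≤ n * n := by
  obtain ⟨A, hA, -, hAc⟩ := exists_card_eq_exPattern ht π n
  rw [← hAc]
  simpa using Finset.card_le_card hA

/-- The Marcus-Tardos theorem. -/
lemma exists_exPattern_le_mul {t : ℕ} (ht : 2 ≤ t) (π : Equiv.Perm (Fin t)) :
    ∃ E : ℕ, ∀ n, exPattern π n ≤ E * n := by
  set s := t ^ 2 with hs
  have hs4 : 4 ≤ s := by nlinarith
  set D := 2 * (t * s.choose t) * (s * s) with hD
  -- The term `s * s` covers small `n` trivially; `2 * D` absorbs the linear term, as `D * (d + 1) ≤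
  -- 2 * D * d`.
  refine ⟨2 * D + s * s, fun n => ?_⟩
  induction n using Nat.strong_induction_on with
  | _ n ih =>
    rcases le_or_gt n (s * s) with hn | hn
    · calc exPattern π n ≤ n * n := exPattern_le_sq (by omega) π n
        _ ≤ (2 * D + s * s) * n := by gcongr; omega
    · have hrec := exPattern_recurrence (by omega) π (s := s) (by omega) n
      rw [← hD] at hrec
      obtain ⟨d, hd⟩ : ∃ d, d = n / s := ⟨_, rfl⟩
      rw [← hd] at hrec
      have hdn : s * d ≤ n := by rw [hd]; exact Nat.mul_div_le n s
      have hsd : s ≤ d := by rw [hd, Nat.le_div_iff_mul_le (by omega)]; exact hn.le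
      have hlt : d + 1 < n := by nlinarith
      have h1 := ih (d + 1) hlt
      set E := 2 * D + s * s with hE
      have hkey : (t - 1) ^ 2 * (E * (d + 1)) + D * (d + 1) ≤ E * (s * d) := by
        obtain ⟨u, rfl⟩ : ∃ u, t = u + 1 := ⟨t - 1, by omega⟩
        have h2 : D * (d + 1) ≤ E * d := by nlinarith
        -- With `s = (u + 1) ^ 2` this reduces to `u ^ 2 ≤ 2 * u * d`; the choice `s = t ^ 2 > (t -
        -- 1) ^ 2` makes the recurrence contract.
        have h3 : u ^ 2 * (d + 1) + d ≤ s * d := by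
          rw [hs] at hsd ⊢
          nlinarith
        calc (u + 1 - 1) ^ 2 * (E * (d + 1)) + D * (d + 1)
            ≤ u ^ 2 * (E * (d + 1)) + E * d := by simpa using h2
          _ = E * (u ^ 2 * (d + 1) + d) := by ring
          _ ≤ E * (s * d) := by gcongr
      calc exPattern π n ≤ (t - 1) ^ 2 * exPattern π (d + 1) + D * (d + 1) := hrec
        _ ≤ (t - 1) ^ 2 * (E * (d + 1)) + D * (d + 1) := by gcongr
        _ ≤ E * (s * d) := hkey
        _ ≤ E * n := by gcongr

/-! ### The Füredi-Hajnal limit -/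

lemma exPattern_one {t : ℕ} (ht : 2 ≤ t) (π : Equiv.Perm (Fin t)) : 1 ≤ exPattern π 1 := by
  have := card_le_exPattern π (m := 1) (A := {(0, 0)}) (by simp) ?_
  · simpa using this
  · rintro ⟨r, c, -, hc, h⟩
    have h0 := h ⟨0, by omega⟩
    have h1 := h ⟨1, by omega⟩
    have := hc (show (⟨0, by omega⟩ : Fin t) < ⟨1, by omega⟩ by simp)
    simp only [Finset.mem_singleton, Prod.mk.injEq] at h0 h1
    omega

/-- Fekete's lemma for `-exPattern π` gives convergence and identifies the limit as a supremum,
whence the bound at every single `m`. -/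
lemma furediHajnal_spec {t : ℕ} (ht : 2 ≤ t) (π : Equiv.Perm (Fin t)) :
    Tendsto (fun m : ℕ => (exPattern π m : ℝ) / (m : ℝ)) atTop (𝓝 (furediHajnalLimit π)) ∧
      ∀ m : ℕ, (exPattern π m : ℝ) ≤ furediHajnalLimit π * m := by
  have hsub : Subadditive (fun m : ℕ => -(exPattern π m : ℝ)) := by
    intro m n
    have := exPattern_superadditive (by omega) π m n
    have : (exPattern π m : ℝ) + exPattern π n ≤ exPattern π (m + n) := by exact_mod_cast this
    linarith
  obtain ⟨E, hE⟩ := exists_exPattern_le_mul ht π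
  have hbdd : BddBelow (Set.range fun m : ℕ => -(exPattern π m : ℝ) / m) := by
    refine ⟨-E, ?_⟩
    rintro _ ⟨m, rfl⟩
    have h : (exPattern π m : ℝ) ≤ E * m := by exact_mod_cast hE m
    show -(E : ℝ) ≤ -(exPattern π m : ℝ) / m
    rw [neg_div, neg_le_neg_iff]
    exact div_le_of_le_mul₀ (by positivity) (by positivity) h
  have hlim : Tendsto (fun m : ℕ => (exPattern π m : ℝ) / (m : ℝ)) atTop (𝓝 (-hsub.lim)) := by
    simpa [neg_div] using (hsub.tendsto_lim hbdd).neg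
  have heq : furediHajnalLimit π = -hsub.lim := hlim.limUnder_eq
  refine ⟨heq ▸ hlim, fun m => ?_⟩
  rcases Nat.eq_zero_or_pos m with rfl | hm
  · simp [exPattern_zero (show 0 < t by omega)]
  have := hsub.lim_le_div hbdd hm.ne'
  rw [neg_div] at this
  rw [heq, ← div_le_iff₀ (by exact_mod_cast hm)]
  linarith

lemma one_le_furediHajnalLimit {t : ℕ} (ht : 2 ≤ t) (π : Equiv.Perm (Fin t)) :
    1 ≤ furediHajnalLimit π := by
  have h := (furediHajnal_spec ht π).2 1
  have h1 : (1 : ℝ) ≤ exPattern π 1 := by exact_mod_cast exPattern_one ht π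
  simpa using h1.trans h

/-! ### Server schedules -/

/-- A schedule for servers indexed by `ι` with positions in `[a, a + h]`, all starting at `a`, that
serves the requests of `X` at the times in `S` and costs at most `w` up to time `N`. -/
def HasSchedule (X : ℕ → ℝ) (N : ℕ) (S : Finset ℕ) (a h : ℝ) (ι : Type) [Fintype ι] (w : ℝ) :
    Prop :=
  ∃ p : ℕ → ι → ℝ, (∀ i j, p i j ∈ Set.Icc a (a + h)) ∧ (∀ j, p 0 j = a) ∧
    (∀ i ∈ S, ∃ j, p (i + 1) j = X i) ∧
    ∑ i ∈ Finset.range N, ∑ j, |p (i + 1) j - p i j| ≤ w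

/-- Spare servers stay parked at `a` for free. -/
lemma HasSchedule.mono_card {X : ℕ → ℝ} {N : ℕ} {S : Finset ℕ} {a h w : ℝ} {ι κ : Type}
    [Fintype ι] [Fintype κ] (hh : 0 ≤ h) (hcard : Fintype.card ι ≤ Fintype.card κ)
    (H : HasSchedule X N S a h ι w) : HasSchedule X N S a h κ w := by
  obtain ⟨p, hp, hp0, hpS, hpw⟩ := H
  obtain ⟨e⟩ := Function.Embedding.nonempty_of_card_le hcard
  have hval : ∀ i j, Function.extend e (p i) (fun _ => a) (e j) = p i j :=
    fun i j => e.injective.extend_apply _ _ _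
  have hout : ∀ i x, x ∉ Set.range e → Function.extend e (p i) (fun _ => a) x = a :=
    fun i x hx => Function.extend_apply' _ _ _ hx
  refine ⟨fun i => Function.extend e (p i) (fun _ => a), fun i x => ?_, fun x => ?_,
    fun i hi => ?_, ?_⟩
  · by_cases hx : x ∈ Set.range e
    · obtain ⟨j, rfl⟩ := hx
      simpa only [hval] using hp i j
    · simp only [hout i x hx]
      exact ⟨le_rfl, by linarith⟩
  · by_cases hx : x ∈ Set.range e
    · obtain ⟨j, rfl⟩ := hx
      simpa only [hval] using hp0 j
    · exact hout 0 x hx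
  · obtain ⟨j, hj⟩ := hpS i hi
    exact ⟨e j, (hval _ _).trans hj⟩
  · refine le_trans (le_of_eq (Finset.sum_congr rfl fun i _ => ?_)) hpw
    refine (Fintype.sum_of_injective e e.injective _ _ (fun x hx => ?_) fun j => ?_).symm
    · simp only [hout _ x hx, sub_self, abs_zero]
    · simp only [hval]

lemma abs_sub_le_of_mem_Icc {a h x y : ℝ} (hx : x ∈ Set.Icc a (a + h))
    (hy : y ∈ Set.Icc a (a + h)) : |x - y| ≤ h := by
  rw [abs_le]
  exact ⟨by linarith [hx.1, hy.2], by linarith [hx.2, hy.1]⟩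

/-- A single server moves to every request. -/
lemma hasSchedule_single (X : ℕ → ℝ) (N : ℕ) (S : Finset ℕ) {a h : ℝ} (hh : 0 ≤ h)
    (hX : ∀ i ∈ S, X i ∈ Set.Icc a (a + h)) :
    HasSchedule X N S a h (Fin 1) (h * S.card) := by
  let p : ℕ → ℝ := fun i => Nat.rec a (fun i x => if i ∈ S then X i else x) i
  have hp0 : p 0 = a := rfl
  have hps : ∀ i, p (i + 1) = if i ∈ S then X i else p i := fun i => rfl
  have hmem : ∀ i, p i ∈ Set.Icc a (a + h) := by
    intro i
    induction i with
    | zero => exact ⟨hp0.ge, by rw [hp0]; linarith⟩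
    | succ i ih =>
      rw [hps]
      split_ifs with hi
      · exact hX i hi
      · exact ih
  refine ⟨fun i _ => p i, fun i _ => hmem i, fun _ => hp0, fun i hi => ⟨0, ?_⟩, ?_⟩
  · simp only [hps, hi, if_true]
  · have hstep : ∀ i ∈ Finset.range N, ∑ _j : Fin 1, |p (i + 1) - p i| ≤
        if i ∈ S then h else 0 := by
      intro i _
      rw [Fin.sum_univ_one]
      split_ifs with hi
      · exact abs_sub_le_of_mem_Icc (hmem (i + 1)) (hmem i)
      · simp [hps, hi]
    refine (Finset.sum_le_sum hstep).trans ?_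
    rw [Finset.sum_ite_mem, Finset.sum_const, nsmul_eq_mul, mul_comm]
    gcongr
    exact Finset.inter_subset_right

/-! ### Strips, greedy blocks and their number -/

/-- Greedy blocks: time is cut into consecutive blocks so that at most `q` labels occur in each
block, and at least `q` in each block but the last. -/
lemma exists_greedy_blocks {α : Type*} [DecidableEq α] (s : ℕ → α) {q : ℕ} (hq : 1 ≤ q)
    (S : Finset ℕ) :
    ∃ b : ℕ → ℕ, Monotone b ∧
      (∀ β, ((S.filter fun i => b i = β).image s).card ≤ q) ∧
      ∀ i, ∀ β < b i, q ≤ ((S.filter fun i => b i = β).image s).card := by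
  induction S using Finset.induction_on_max with
  | empty => exact ⟨fun _ => 0, monotone_const, by simp, by simp⟩
  | insert a S ha ih =>
    obtain ⟨b, hb, hle, hge⟩ := ih
    -- As `a` exceeds all of `S`, the block function may be overwritten from `a` on by a constant:
    -- `b a` if the new label still fits, `b a + 1` otherwise.
    have hmono : ∀ v, b a ≤ v → Monotone fun i => if i < a then b i else v := by
      intro v hv i j hij
      dsimp only
      split_ifs with h1 h2 h2
      · exact hb hij
      · exact (hb h1.le).trans hv
      · omega
      · exact le_rfl
    have hfilter : ∀ v β, (S.filter fun i => (if i < a then b i else v) = β) =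
        S.filter fun i => b i = β := by
      intro v β
      refine Finset.filter_congr fun i hi => ?_
      rw [if_pos (ha i hi)]
    by_cases hc : (insert (s a) ((S.filter fun i => b i = b a).image s)).card ≤ q
    · refine ⟨_, hmono (b a) le_rfl, fun β => ?_, fun i β hβ => ?_⟩
      · rw [Finset.filter_insert, hfilter, if_neg (lt_irrefl a)]
        split_ifs with h
        · rw [Finset.image_insert, ← h]
          exact hc
        · exact hle β
      · have hβ' : β < b a := by
          split_ifs at hβ with h
          · exact hβ.trans_le (hb h.le)
          · exact hβ
        refine (hge a β hβ').trans (Finset.card_le_card (Finset.image_subset_image ?_))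
        rw [← hfilter (b a)]
        exact Finset.filter_subset_filter _ (Finset.subset_insert _ _)
    · push Not at hc
      refine ⟨_, hmono (b a + 1) (Nat.le_succ _), fun β => ?_, fun i β hβ => ?_⟩
      · rw [Finset.filter_insert, hfilter, if_neg (lt_irrefl a)]
        split_ifs with h
        · have : (S.filter fun i => b i = β) = ∅ := by
            refine Finset.filter_eq_empty_iff.2 fun i hi => ?_
            have := hb (ha i hi).le
            omega
          rw [this]
          simpa using hq
        · exact hle β
      · have hβ' : β < b a + 1 := by
          split_ifs at hβ with h
          · exact (hβ.trans_le (hb h.le)).trans (Nat.lt_succ_self _)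
          · exact hβ
        refine le_trans ?_ (Finset.card_le_card (Finset.image_subset_image
          (Finset.filter_subset_filter _ (Finset.subset_insert a S))))
        rw [hfilter]
        rcases Nat.lt_succ_iff_lt_or_eq.1 hβ' with h | rfl
        · exact hge a β h
        · have := Finset.card_insert_le (s a) ((S.filter fun i => b i = b a).image s)
          omega

/-- Cutting `[a, a + h]` into `m` strips. -/
lemma exists_strips (X : ℕ → ℝ) (S : Finset ℕ) {a h : ℝ} (hh : 0 < h) {m : ℕ} (hm : 1 ≤ m)
    (hX : ∀ i ∈ S, X i ∈ Set.Icc a (a + h)) :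
    ∃ s : ℕ → ℕ, (∀ i, s i < m) ∧ (∀ i j, s i < s j → X i < X j) ∧
      ∀ i ∈ S, X i ∈ Set.Icc (a + s i * (h / m)) (a + s i * (h / m) + h / m) := by
  have hm0 : (0 : ℝ) < m := by exact_mod_cast hm
  have hd : 0 < h / m := div_pos hh hm0
  -- The cap `m - 1` puts the endpoint `a + h` into the top strip and keeps labels below `m` even at
  -- times outside `S`.
  refine ⟨fun i => min ⌊(X i - a) / (h / m)⌋₊ (m - 1), fun i => ?_, fun i j hij => ?_,
    fun i hi => ?_⟩
  · dsimp only
    omega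
  · by_contra hle
    push Not at hle
    have : ⌊(X j - a) / (h / m)⌋₊ ≤ ⌊(X i - a) / (h / m)⌋₊ := by gcongr
    dsimp only at hij
    omega
  · obtain ⟨h1, h2⟩ := hX i hi
    have hz : 0 ≤ (X i - a) / (h / m) := div_nonneg (by linarith) hd.le
    have hfl := Nat.floor_le hz
    have hlt := Nat.lt_floor_add_one ((X i - a) / (h / m))
    constructor
    · have : ((min ⌊(X i - a) / (h / m)⌋₊ (m - 1) : ℕ) : ℝ) ≤ (X i - a) / (h / m) :=
        le_trans (by exact_mod_cast min_le_left _ _) hfl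
      rw [le_div_iff₀ hd] at this
      linarith
    · dsimp only
      rcases le_total ⌊(X i - a) / (h / m)⌋₊ (m - 1) with hc | hc
      · rw [min_eq_left hc]
        rw [div_lt_iff₀ hd] at hlt
        linarith
      · rw [min_eq_right hc, Nat.cast_sub hm]
        have : (m : ℝ) * (h / m) = h := by field_simp
        push_cast
        linarith

/-- With more than `c` labels per full block there are at most `m` blocks. -/
lemma greedy_blocks_lt {t : ℕ} {π : Equiv.Perm (Fin t)} {c : ℝ}
    (hc : ∀ m : ℕ, (exPattern π m : ℝ) ≤ c * m) {q : ℕ} (hq : c < q) {X : ℕ → ℝ} {N : ℕ}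
    (hπ : ¬ ∃ f : Fin t → ℕ, StrictMono f ∧ (∀ i, f i < N) ∧
      ∀ i j, X (f i) < X (f j) ↔ π i < π j)
    {S : Finset ℕ} (hS : S ⊆ Finset.range N) {m : ℕ} (hm : 1 ≤ m) {s b : ℕ → ℕ}
    (hs : ∀ i, s i < m) (hsX : ∀ i j, s i < s j → X i < X j) (hb : Monotone b)
    (hge : ∀ i, ∀ β < b i, q ≤ ((S.filter fun i => b i = β).image s).card) (i : ℕ) :
    b i < m := by
  by_contra hlt
  push Not at hlt
  set A := (S.filter fun i => b i < m).image fun i => (s i, b i) with hA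
  have hAm : A ⊆ Finset.range m ×ˢ Finset.range m := by
    intro x hx
    obtain ⟨i, hi, rfl⟩ := Finset.mem_image.1 hx
    simp [hs, (Finset.mem_filter.1 hi).2]
  -- Increasing block indices force increasing times and increasing strip indices force increasing
  -- values, so a copy in `A` lifts to `X`.
  have hAπ : ¬ PointsContain A π := by
    rintro ⟨r, c, hr, hc, h⟩
    simp only [hA, Finset.mem_image, Finset.mem_filter, Prod.mk.injEq] at h
    choose f hf hf1 hf2 using h
    refine hπ ⟨f, fun i j hij => ?_, fun i => Finset.mem_range.1 (hS (hf i).1), ?_⟩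
    · by_contra hle
      have := hb (not_lt.1 hle)
      rw [hf2, hf2] at this
      exact absurd (hc hij) (not_lt.2 this)
    · have key : ∀ i j, π i < π j → X (f i) < X (f j) := fun i j hij =>
        hsX _ _ (by rw [hf1, hf1]; exact hr hij)
      refine fun i j => ⟨fun hlt => ?_, key i j⟩
      rcases lt_trichotomy (π i) (π j) with h | h | h
      · exact h
      · rw [π.injective h] at hlt
        exact absurd hlt (lt_irrefl _)
      · exact absurd hlt (key j i h).not_gt
  have hcard : q * m ≤ A.card := by
    rw [Finset.card_eq_sum_card_fiberwise (f := Prod.snd) (t := Finset.range m)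
      (fun x hx => (Finset.mem_product.1 (hAm hx)).2)]
    have : ∀ β ∈ Finset.range m, q ≤ (A.filter fun x => x.2 = β).card := by
      intro β hβ
      rw [Finset.mem_range] at hβ
      refine (hge i β (by omega)).trans ?_
      rw [← Finset.card_image_of_injective _ (Prod.mk_left_injective β)]
      refine Finset.card_le_card fun x hx => ?_
      obtain ⟨y, hy, rfl⟩ := Finset.mem_image.1 hx
      obtain ⟨j, hj, rfl⟩ := Finset.mem_image.1 hy
      obtain ⟨hj1, rfl⟩ := Finset.mem_filter.1 hj
      simp only [hA, Finset.mem_filter, Finset.mem_image, Prod.mk.injEq, and_true]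
      exact ⟨j, ⟨hj1, hβ⟩, rfl, rfl⟩
    simpa [mul_comm] using Finset.sum_le_sum this
  have h1 := hcard.trans (card_le_exPattern π hAm hAπ)
  have h2 : (q : ℝ) * m ≤ exPattern π m := by exact_mod_cast h1
  have h3 := hc m
  have hm0 : (0 : ℝ) < m := by exact_mod_cast hm
  nlinarith

/-- The number of times at which a monotone block function changes (time `0` included). -/
lemma card_switches_le {b : ℕ → ℕ} (hb : Monotone b) {m : ℕ} (hm : ∀ i, b i < m) (N : ℕ) :
    ((Finset.range N).filter fun i => i = 0 ∨ b (i - 1) ≠ b i).card ≤ m := by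
  have key : ∀ N, ((Finset.range (N + 1)).filter fun i => i = 0 ∨ b (i - 1) ≠ b i).card
      ≤ b N + 1 := by
    intro N
    induction N with
    | zero => exact (Finset.card_filter_le _ _).trans (by simp)
    | succ N ih =>
      rw [Finset.range_add_one, Finset.filter_insert]
      have h1 := hb (Nat.le_succ N)
      by_cases h : N + 1 = 0 ∨ b (N + 1 - 1) ≠ b (N + 1)
      · have h2 : b N ≠ b (N + 1) := by simpa using h
        rw [if_pos h]
        refine (Finset.card_insert_le _ _).trans ?_
        simp only [Nat.succ_eq_add_one] at h1
        omega
      · rw [if_neg h]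
        exact ih.trans (by simpa using h1)
  cases N with
  | zero => simp
  | succ N => exact (key N).trans (hm N)

/-! ### The recursive schedule -/

/-- Combining schedules of the cells: during block `β` the slot `u` follows the schedule of the
cell `(β, u)`. -/
lemma hasSchedule_combine {X : ℕ → ℝ} {N : ℕ} {S : Finset ℕ} {a h h' : ℝ} (hh : 0 ≤ h)
    {q m : ℕ} {ι : Type} [Fintype ι] {b : ℕ → ℕ} (hb : Monotone b) (hbm : ∀ i, b i < m)
    {g : ℕ → Fin q} {o : ℕ → Fin q → ℝ} {w : ℕ → Fin q → ℝ}
    (ho : ∀ β u, a ≤ o β u ∧ o β u + h' ≤ a + h)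
    (H : ∀ β u, HasSchedule X N (S.filter fun i => b i = β ∧ g i = u) (o β u) h' ι (w β u)) :
    HasSchedule X N S a h (Fin q × ι)
      (m * (q * Fintype.card ι * h) + ∑ β ∈ Finset.range m, ∑ u, w β u) := by
  choose p hp hp0 hpS hpw using H
  -- State `i` is the one after request `i - 1`, hence the block `b (i - 1)`. State `0` is set to
  -- `a` because the cell schedules start at their own offsets; leaving it is counted as a switch.
  let P : ℕ → Fin q × ι → ℝ := fun i x => if i = 0 then a else p (b (i - 1)) x.1 i x.2
  have hP : ∀ i x, P i x ∈ Set.Icc a (a + h) := by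
    intro i x
    by_cases hi : i = 0
    · simp [P, hi, hh]
    · simp only [P, hi, if_false]
      have h1 := hp (b (i - 1)) x.1 i x.2
      have h2 := ho (b (i - 1)) x.1
      exact ⟨h2.1.trans h1.1, h1.2.trans h2.2⟩
  refine ⟨P, hP, fun x => by simp [P], fun i hi => ?_, ?_⟩
  · obtain ⟨j, hj⟩ := hpS (b i) (g i) i (by simp [hi])
    exact ⟨(g i, j), by simpa [P] using hj⟩
  · set D : ℕ → ℕ → ℝ := fun β i => ∑ u, ∑ j, |p β u (i + 1) j - p β u i j| with hD
    have hD0 : ∀ β i, 0 ≤ D β i := fun β i =>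
      Finset.sum_nonneg fun _ _ => Finset.sum_nonneg fun _ _ => abs_nonneg _
    -- At a switch every server moves at most `h`; otherwise the move belongs to the current block
    -- and is charged to the sum over all blocks.
    have hstep : ∀ i ∈ Finset.range N, ∑ x, |P (i + 1) x - P i x| ≤
        (if i = 0 ∨ b (i - 1) ≠ b i then (q * Fintype.card ι * h : ℝ) else 0) +
          ∑ β ∈ Finset.range m, D β i := by
      intro i _
      split_ifs with hi
      · have h1 : ∑ x, |P (i + 1) x - P i x| ≤ ∑ _x : Fin q × ι, h :=
          Finset.sum_le_sum fun x _ => abs_sub_le_of_mem_Icc (hP _ _) (hP _ _)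
        have h2 : ∑ _x : Fin q × ι, h = q * Fintype.card ι * h := by simp
        have h3 : 0 ≤ ∑ β ∈ Finset.range m, D β i := Finset.sum_nonneg fun β _ => hD0 β i
        linarith
      · push Not at hi
        have h1 : ∑ x, |P (i + 1) x - P i x| = D (b i) i := by
          rw [Fintype.sum_prod_type]
          simp only [P, hD, hi.1, hi.2, if_false, Nat.add_eq_zero_iff, one_ne_zero, and_false,
            Nat.add_sub_cancel]
        rw [h1, zero_add]
        exact Finset.single_le_sum (f := fun β => D β i) (fun β _ => hD0 β i)
          (Finset.mem_range.2 (hbm i))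
    refine (Finset.sum_le_sum hstep).trans ?_
    rw [Finset.sum_add_distrib]
    refine add_le_add ?_ ?_
    · rw [← Finset.sum_filter, Finset.sum_const, nsmul_eq_mul]
      gcongr
      exact card_switches_le hb hbm N
    · rw [Finset.sum_comm]
      refine Finset.sum_le_sum fun β _ => ?_
      simp only [hD]
      rw [Finset.sum_comm]
      exact Finset.sum_le_sum fun u _ => hpw β u

/-- Recursive schedules with `q ^ l` servers and `m` strips at each level. -/
lemma hasSchedule_levels {t : ℕ} {π : Equiv.Perm (Fin t)} {c : ℝ}
    (hc : ∀ m : ℕ, (exPattern π m : ℝ) ≤ c * m) {q : ℕ} (hq1 : 1 ≤ q) (hq : c < q) {X : ℕ → ℝ}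
    {N : ℕ} (hπ : ¬ ∃ f : Fin t → ℕ, StrictMono f ∧ (∀ i, f i < N) ∧
      ∀ i j, X (f i) < X (f j) ↔ π i < π j) {m : ℕ} (hm : 1 ≤ m) (l : ℕ) :
    ∀ (S : Finset ℕ) (_ : S ⊆ Finset.range N) (a h : ℝ) (_ : 0 < h)
      (_ : ∀ i ∈ S, X i ∈ Set.Icc a (a + h)),
      HasSchedule X N S a h (Fin (q ^ l)) (h * (q ^ l * (l * m + S.card / m ^ l))) := by
  induction l with
  | zero =>
    intro S _ a h hh hX
    have H := (hasSchedule_single X N S hh.le hX).mono_card (κ := Fin (q ^ 0)) hh.le (by simp)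
    rwa [show h * S.card = h * ((q : ℝ) ^ 0 * ((0 : ℕ) * m + S.card / (m : ℝ) ^ 0)) by simp] at H
  | succ l ih =>
    intro S hS a h hh hX
    have hm0 : (0 : ℝ) < m := by exact_mod_cast hm
    obtain ⟨s, hs, hsX, hstrip⟩ := exists_strips X S hh hm hX
    obtain ⟨b, hb, hle, hge⟩ := exists_greedy_blocks s hq1 S
    have hbm := greedy_blocks_lt hc hq hπ hS hm hs hsX hb hge
    have hslot : ∀ β, ∃ e : ℕ → Fin q,
        Set.InjOn e ((S.filter fun i => b i = β).image s : Finset ℕ) := by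
      intro β
      obtain ⟨f⟩ := Function.Embedding.nonempty_of_card_le
        (α := ((S.filter fun i => b i = β).image s : Finset ℕ)) (β := Fin q) (by simpa using hle β)
      refine ⟨fun x => if hx : x ∈ (S.filter fun i => b i = β).image s then f ⟨x, hx⟩ else ⟨0, hq1⟩,
        fun x hx y hy hxy => ?_⟩
      simp only [dif_pos (Finset.mem_coe.1 hx), dif_pos (Finset.mem_coe.1 hy)] at hxy
      simpa using f.injective hxy
    choose e he using hslot
    -- Slots are injective on the strips of a block, so each cell sees one strip; an empty cell gets
    -- strip `0`.
    have hcell : ∀ β (u : Fin q), ∃ σ < m, ∀ i ∈ S, b i = β → e (b i) (s i) = u → s i = σ := by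
      intro β u
      by_cases hne : ∃ i ∈ S, b i = β ∧ e (b i) (s i) = u
      · obtain ⟨i, hi, rfl, rfl⟩ := hne
        refine ⟨s i, hs i, fun j hj hbj hej => he (b i) ?_ ?_ ?_⟩
        · exact Finset.mem_coe.2 (Finset.mem_image_of_mem s (by simp [hj, hbj]))
        · exact Finset.mem_coe.2 (Finset.mem_image_of_mem s (by simp [hi]))
        · rw [← hej, hbj]
      · push Not at hne
        exact ⟨0, hm, fun i hi hbi hei => absurd hei (hne i hi hbi)⟩
    choose σ hσm hσ using hcell
    have hH := hasSchedule_combine (X := X) (N := N) (S := S) (a := a) (h := h) (h' := h / m)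
      hh.le hb hbm (g := fun i => e (b i) (s i)) (o := fun β u => a + σ β u * (h / m))
      (fun β u => by
        have h1 : ((σ β u : ℝ) + 1) ≤ m := by exact_mod_cast hσm β u
        have h2 : (m : ℝ) * (h / m) = h := by field_simp
        have h3 : 0 < h / m := div_pos hh hm0
        have h4 : ((σ β u : ℝ) + 1) * (h / m) ≤ m * (h / m) := by gcongr
        refine ⟨by nlinarith [mul_nonneg (Nat.cast_nonneg (σ β u) : (0 : ℝ) ≤ σ β u) h3.le], ?_⟩
        linarith)
      (fun β u => ih (S.filter fun i => b i = β ∧ e (b i) (s i) = u)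
        ((Finset.filter_subset _ _).trans hS) (a + σ β u * (h / m)) (h / m) (div_pos hh hm0)
        (fun i hi => by
          obtain ⟨hi1, hi2, hi3⟩ := Finset.mem_filter.1 hi
          have := hstrip i hi1
          rwa [hσ β u i hi1 hi2 hi3] at this))
    have hcards : ∑ β ∈ Finset.range m, ∑ u : Fin q,
        (((S.filter fun i => b i = β ∧ e (b i) (s i) = u).card : ℕ) : ℝ) = S.card := by
      rw [Finset.card_eq_sum_card_fiberwise (f := b) (s := S)
        (t := Finset.range m) fun i _ => by simpa using hbm i]
      push_cast
      refine Finset.sum_congr rfl fun β _ => ?_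
      rw [Finset.card_eq_sum_card_fiberwise (f := fun i => e (b i) (s i))
        (t := (Finset.univ : Finset (Fin q))) fun i _ => by simp]
      push_cast
      simp only [Finset.filter_filter]
    have hH' := hH.mono_card (κ := Fin (q ^ (l + 1))) hh.le (by simp [pow_succ, mul_comm])
    obtain ⟨p, hp, hp0, hpS, hpw⟩ := hH'
    refine ⟨p, hp, hp0, hpS, hpw.trans ?_⟩
    have hsum : ∑ β ∈ Finset.range m, ∑ u : Fin q, h / m * ((q : ℝ) ^ l * (l * m +
        ((S.filter fun i => b i = β ∧ e (b i) (s i) = u).card : ℝ) / m ^ l)) =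
        h / m * ((q : ℝ) ^ l * (m * (q * (l * m)) + S.card / m ^ l)) := by
      rw [← hcards]
      simp only [← Finset.mul_sum, Finset.sum_add_distrib, ← Finset.sum_div]
      simp only [Finset.sum_const, Finset.card_univ, Fintype.card_fin, Finset.card_range,
        nsmul_eq_mul]
      ring
    rw [hsum]
    have h5 : h / m * ((q : ℝ) ^ l * (m * (q * (l * m)) + S.card / m ^ l)) =
        h * (q ^ (l + 1) * (l * m)) + h * (q ^ l * (S.card / m ^ (l + 1))) := by
      field_simp
      ring
    -- Only the switching terms gain a factor `q`, since the request counts of the cells sum to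
    -- `S.card`; the factor is given away here to keep the bound uniform.
    have h6 : h * ((q : ℝ) ^ l * (S.card / m ^ (l + 1))) ≤
        h * (q ^ (l + 1) * (S.card / m ^ (l + 1))) := by
      have : (1 : ℝ) ≤ q := by exact_mod_cast hq1
      gcongr
      omega
    rw [h5]
    simp only [Fintype.card_fin]
    push_cast
    have h7 : (m : ℝ) * (q * q ^ l * h) = h * (q ^ (l + 1) * m) := by ring
    linarith

/-! ### Choice of parameters -/

lemma kServerOPT_le_of_hasSchedule {n k : ℕ} {X : Fin n → ℝ} {Y : ℕ → ℝ}
    (hY : ∀ i : Fin n, Y i = X i) {w : ℝ}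
    (H : HasSchedule Y n (Finset.range n) 0 1 (Fin k) w) : kServerOPT k X ≤ w := by
  obtain ⟨p, hp, hp0, hpS, hpw⟩ := H
  have hle : kServerOPT k X ≤ kServerCost (n := n) (k := k) fun i j => p i j := by
    refine csInf_le ⟨0, ?_⟩ ⟨fun i j => p i j, ⟨fun i j => by simpa using hp i j,
      fun j => by simpa using hp0 j, fun i => ?_⟩, rfl⟩
    · rintro _ ⟨q, -, rfl⟩
      exact Finset.sum_nonneg fun _ _ => Finset.sum_nonneg fun _ _ => abs_nonneg _
    · obtain ⟨j, hj⟩ := hpS i (Finset.mem_range.2 i.2)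
      exact ⟨j, by simpa [hY] using hj⟩
  refine hle.trans (le_trans (le_of_eq ?_) hpw)
  simp only [kServerCost, Fin.val_succ, Fin.val_castSucc]
  exact Fin.sum_univ_eq_sum_range (fun i => ∑ j, |p (i + 1) j - p i j|) n

/-- The bound for a fixed number `l` of levels and `m` strips. -/
lemma kServerOPT_le_levels {t : ℕ} {π : Equiv.Perm (Fin t)} {c : ℝ}
    (hc : ∀ m : ℕ, (exPattern π m : ℝ) ≤ c * m) {q : ℕ} (hq1 : 1 ≤ q) (hq : c < q) {n k l m : ℕ}
    (hm : 1 ≤ m) (hk : q ^ l ≤ k) {X : Fin n → ℝ} (hX : ∀ i, X i ∈ Set.Icc (0 : ℝ) 1)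
    (hπ : SeqAvoids X π) :
    kServerOPT k X ≤ (q : ℝ) ^ l * (l * m + n / (m : ℝ) ^ l) := by
  let Y : ℕ → ℝ := fun i => if h : i < n then X ⟨i, h⟩ else 0
  have hY : ∀ i : Fin n, Y i = X i := fun i => by simp [Y]
  have hYπ : ¬ ∃ f : Fin t → ℕ, StrictMono f ∧ (∀ i, f i < n) ∧
      ∀ i j, Y (f i) < Y (f j) ↔ π i < π j := by
    rintro ⟨f, hf, hfn, h⟩
    refine hπ ⟨fun i => ⟨f i, hfn i⟩, fun i j hij => hf hij, fun i j => ?_⟩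
    rw [← hY, ← hY]
    exact h i j
  have H := hasSchedule_levels hc hq1 hq hYπ hm l (Finset.range n) subset_rfl 0 1 one_pos
    (fun i hi => by
      rw [hY ⟨i, Finset.mem_range.1 hi⟩]
      simpa using hX ⟨i, Finset.mem_range.1 hi⟩)
  have := kServerOPT_le_of_hasSchedule hY
    (H.mono_card (κ := Fin k) zero_le_one (by simpa using hk))
  simpa using this

theorem theoremp :
    ∃ C : ℝ, 0 < C ∧ ∀ (t : ℕ) (_ : 2 ≤ t) (π : Equiv.Perm (Fin t)),
      Tendsto (fun m : ℕ => (exPattern π m : ℝ) / (m : ℝ)) atTop (𝓝 (furediHajnalLimit π)) ∧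
      ∀ (k : ℕ) (_ : 1 ≤ k) (n : ℕ) (X : Fin n → ℝ) (_ : ∀ i, X i ∈ Set.Icc (0 : ℝ) 1)
        (_ : Function.Injective X) (_ : SeqAvoids X π),
        kServerOPT k X ≤
          C * (k : ℝ) ^ (1 + Real.logb (5 * furediHajnalLimit π) 120)
            * (n : ℝ) ^ (1 / ((⌊Real.logb (5 * furediHajnalLimit π) (k : ℝ)⌋₊ : ℝ) + 1)) := by
  refine ⟨1, one_pos, fun t ht π => ⟨(furediHajnal_spec ht π).1, ?_⟩⟩
  intro k hk n X hX _ hπ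
  have hc := (furediHajnal_spec ht π).2
  have hc1 := one_le_furediHajnalLimit ht π
  set c := furediHajnalLimit π
  set l := ⌊Real.logb (5 * c) k⌋₊ with hl
  have hb1 : 1 < 5 * c := by linarith
  have hk0 : (0 : ℝ) < k := by exact_mod_cast hk
  have hlog0 : 0 ≤ Real.logb (5 * c) k := Real.logb_nonneg hb1 (by exact_mod_cast hk)
  have hllog : (l : ℝ) ≤ Real.logb (5 * c) k := Nat.floor_le hlog0
  -- As `c ≥ 1`, this integer exceeds `5 * c - 1 > c`, while `q ^ l ≤ (5 * c) ^ l ≤ k`.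
  set q := ⌊5 * c⌋₊ with hq
  have hq5 : (q : ℝ) ≤ 5 * c := Nat.floor_le (by linarith)
  have hqc : c < q := by
    have := Nat.lt_floor_add_one (5 * c)
    rw [← hq] at this
    linarith
  have hq1 : 1 ≤ q := by
    have : (0 : ℝ) < q := by linarith
    exact_mod_cast this
  have hqk : (q : ℝ) ^ l ≤ k := by
    calc (q : ℝ) ^ l ≤ (5 * c) ^ l := by gcongr
      _ = (5 * c) ^ (l : ℝ) := (Real.rpow_natCast _ _).symm
      _ ≤ (5 * c) ^ Real.logb (5 * c) k := Real.rpow_le_rpow_of_exponent_le hb1.le hllog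
      _ = k := Real.rpow_logb (by linarith) hb1.ne' hk0
  have hpow : (120 : ℝ) ^ l ≤ (k : ℝ) ^ Real.logb (5 * c) 120 := by
    have : (k : ℝ) ^ Real.logb (5 * c) 120 = (120 : ℝ) ^ Real.logb (5 * c) k := by
      conv_lhs => rw [← Real.rpow_logb (b := 5 * c) (by linarith) hb1.ne' hk0]
      conv_rhs => rw [← Real.rpow_logb (b := 5 * c) (x := 120) (by linarith) hb1.ne' (by norm_num)]
      rw [← Real.rpow_mul (by linarith), ← Real.rpow_mul (by linarith),
        mul_comm (Real.logb _ _)]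
    rw [this, ← Real.rpow_natCast]
    exact Real.rpow_le_rpow_of_exponent_le (by norm_num) hllog
  set y : ℝ := (n : ℝ) ^ (1 / ((l : ℝ) + 1)) with hy
  -- Bernoulli with ample slack: the level factor `2 * l + 1` is all that the power of `120` must
  -- absorb.
  have hl1 : (2 * (l : ℝ) + 1) ≤ 120 ^ l := by
    have h := one_add_mul_le_pow (a := (119 : ℝ)) (by norm_num) l
    norm_num at h
    have : (0 : ℝ) ≤ l := by positivity
    linarith
  have hbound : kServerOPT k X ≤ (q : ℝ) ^ l * ((2 * l + 1) * y) := by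
    -- For `n = 0` also `y = 0`, so `⌈y⌉₊` would not be a legal number of strips.
    rcases Nat.eq_zero_or_pos n with rfl | hn
    · have h := kServerOPT_le_of_hasSchedule (X := X) (Y := fun _ => 0) (k := k) (w := 0)
        (fun i => i.elim0)
        ⟨fun _ _ => 0, by simp, by simp, by simp, by simp⟩
      exact h.trans (by positivity)
    have hy1 : 1 ≤ y := Real.one_le_rpow (by exact_mod_cast hn) (by positivity)
    have hyl : y ^ (l + 1) = n := by
      rw [hy, ← Real.rpow_natCast, ← Real.rpow_mul (by positivity)]
      push_cast
      rw [one_div_mul_cancel (by positivity), Real.rpow_one]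
    have hym : y ≤ (⌈y⌉₊ : ℝ) := Nat.le_ceil y
    have hm1 : 1 ≤ ⌈y⌉₊ := Nat.one_le_ceil_iff.2 (by linarith)
    refine (kServerOPT_le_levels hc hq1 hqc hm1 (by exact_mod_cast hqk) hX hπ).trans ?_
    have h1 : (⌈y⌉₊ : ℝ) ≤ 2 * y := by
      have := Nat.ceil_lt_add_one (zero_le_one.trans hy1)
      linarith
    have h2 : (n : ℝ) / (⌈y⌉₊ : ℝ) ^ l ≤ y := by
      rw [div_le_iff₀ (by positivity), ← hyl, pow_succ, mul_comm]
      gcongr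
    have h3 : (l : ℝ) * (⌈y⌉₊ : ℝ) ≤ l * (2 * y) := by gcongr
    gcongr
    linarith
  have hy0 : 0 ≤ y := by positivity
  refine hbound.trans ?_
  rw [Real.rpow_add hk0, Real.rpow_one, one_mul]
  calc (q : ℝ) ^ l * ((2 * l + 1) * y) ≤ k * ((k : ℝ) ^ Real.logb (5 * c) 120 * y) := by
        gcongr
        exact hl1.trans hpow
    _ = _ := by ring
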